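/- Throughout, groups are abelian, a cardinal is identified with its initial ordinal, and $\mathrm{Ext}=\mathrm{Ext}^1_{\mathbb Z}$. A group $A$ is a Whitehead group if $\mathrm{Ext}(A,\mathbb Z)=0$. For a regular uncountable cardinal $\kappa$ and $E\subseteq\kappa$, $\diamondsuit_\kappa(E)$ says that there are sets $D_\alpha\subseteq\alpha$ $(\alpha\in E)$ such that for every $X\subseteq\kappa$ the set $\{\alpha\in E: X\cap\alpha=D_\alpha\}$ is stationary in $\kappa$. Let $\mu$ be an infinite cardinal of cofinality $\sigma$ and let $\lambda=\mu^+$. Let $S\subseteq\lambda$ be a set of ordinals of cofinality $\sigma$ and let $\bar\eta=\{\eta_\delta:\delta\in S\}$, where each $\eta_\delta:\sigma\to\delta$ is strictly increasing with range cofinal in $\delta$. If $\sigma>\aleph_0$, let $E$ be a stationary subset of $\sigma$ consisting of limit ordinals of cofinality $\omega$ and let $\bar\zeta=\{\zeta_\nu:\nu\in E\}$, where each $\zeta_\nu:\omega\to\nu$ is strictly increasing with range cofinal in $\nu$. If $\sigma=\aleph_0$, let $E=\{0\}$ and omit $\bar\zeta$ and the symbols $z_{\delta,j}$ below. A group $H$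 is built on $\bar\eta$ and $\bar\zeta$ if $H\cong F/K$, where $F$ is the free abelian group on the symbols $$\{y_{\delta,\nu,n}:\delta\in S,\ \nu\in E,\ n\in\omega\}\cup\{z_{\delta,j}:\delta\in S,\ j\in\sigma\}\cup\{x_\beta:\beta\in\lambda\}$$ and $K$ is the subgroup of $F$ generated by the elements $$w_{\delta,\nu,n}=2y_{\delta,\nu,n+1}-y_{\delta,\nu,n}-z_{\delta,\zeta_\nu(n)}+x_{\eta_\delta(\nu+n)}\qquad(\delta\in S,\ \nu\in E,\ n\in\omega).$$ Theorem. Assume GCH. Let $\lambda=\mu^+$, where $\mu$ is a singular cardinal of cofinality $\sigma<\mu$. Suppose $H$ is built on $\bar\eta=\{\eta_\delta:\delta\in S\}$ and $\bar\zeta=\{\zeta_\nu:\nu\in E\}$ as above, where $S$ is stationary in $\lambda$. Suppose also that $\diamondsuit_\lambda(Y)$ holds for some subset $Y$ of $\lambda$ consisting of limit ordinals of cofinality $\sigma$ and that, if $\sigma>\aleph_0$, $\diamondsuit_\sigma(E)$ holds. If $A$ is a Whitehead group of cardinality $\lambda=\mu^+$, then $\mathrm{Ext}(H,A)\neq 0$.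 -/

import Mathlib

open Cardinal

universe u

/-- The generalized continuum hypothesis. -/
def GCH : Prop :=
  ∀ c : Cardinal.{u}, ℵ₀ ≤ c → (2 : Cardinal.{u}) ^ c = Order.succ c

/-- The set `S` of ordinals is stationary in the ordinal `o`: the part of `S` below `o` meets every
closed unbounded subset of `o`. -/
def StationaryIn (o : Ordinal.{u}) (S : Set Ordinal.{u}) : Prop :=
  IsStationary {α : Set.Iio o | (α : Ordinal.{u}) ∈ S}

/-- The diamond principle `◇_κ(E)`: there are sets `D α ⊆ α` for `α ∈ E` such that for every
`X ⊆ κ` the set of those `α ∈ E` with `X ∩ α = D α` is stationary in `κ`. -/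
def Diamond (κ : Cardinal.{u}) (E : Set Ordinal.{u}) : Prop :=
  ∃ D : Ordinal.{u} → Set Ordinal.{u},
    (∀ α ∈ E, D α ⊆ Set.Iio α) ∧
    ∀ X : Set Ordinal.{u}, X ⊆ Set.Iio κ.ord →
      StationaryIn κ.ord {α | α ∈ E ∧ X ∩ Set.Iio α = D α}

/-- A ladder system on the set `S` of ordinals, with ladders indexed by `I`: for each `δ ∈ S`
a strictly increasing function from `I` to `δ` whose range is cofinal in `δ`. -/
structure LadderSystem (I : Type*) [Preorder I] (S : Set Ordinal.{u}) where
  ladder : (δ : S) → I → Set.Iio (δ : Ordinal.{u})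
  strictMono : ∀ δ, StrictMono (ladder δ)
  cofinal : ∀ δ, IsCofinal (Set.range (ladder δ))

/-- The data from which a group is built: for an infinite cardinal `μ` of cofinality `σ`,
a set `S` of ordinals below `μ⁺` of cofinality `σ` with a ladder system `η` (ladders of length `σ`);
and, if `σ` is uncountable, a stationary subset `E` of `σ` consisting of limit ordinals of
cofinality `ω`, with a ladder system `ζ` (ladders of length `ω`). If `σ` is countable
then `E = {0}` and there is no `ζ`. -/
structure BuildingData (μ : Cardinal.{u}) where
  aleph0_le : ℵ₀ ≤ μ
  S : Set Ordinal.{u}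
  S_lt : ∀ δ ∈ S, δ < (Order.succ μ).ord
  S_cof : ∀ δ ∈ S, δ.cof = μ.ord.cof
  η : LadderSystem (Set.Iio μ.ord.cof.ord) S
  E : Set Ordinal.{u}
  E_lt : ∀ ν ∈ E, ν < μ.ord.cof.ord
  E_eq : μ.ord.cof = ℵ₀ → E = {0}
  E_stationary : ℵ₀ < μ.ord.cof → StationaryIn μ.ord.cof.ord E
  E_cof : ℵ₀ < μ.ord.cof → ∀ ν ∈ E, ν.cof = ℵ₀
  ζ : ℵ₀ < μ.ord.cof → LadderSystem ℕ E

namespace BuildingData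

variable {μ : Cardinal.{u}} (D : BuildingData μ)

/-- The free generators `y_{δ,ν,n}`, `z_{δ,j}` and `x_β`, where the `z_{δ,j}` are
present only if the cofinality of `μ` is uncountable. -/
inductive Gen : Type (u + 1)
  | y (δ : D.S) (ν : D.E) (n : ℕ) : Gen
  | z (hσ : ℵ₀ < μ.ord.cof) (δ : D.S) (j : Set.Iio μ.ord.cof.ord) : Gen
  | x (β : Set.Iio (Order.succ μ).ord) : Gen

/-- The free abelian group `F` on the generators. -/
abbrev F : Type (u + 1) := FreeAbelianGroup D.Gen

/-- The ordinal `ν + n`, as an element of `σ`. -/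
def shift (ν : D.E) (n : ℕ) : Set.Iio μ.ord.cof.ord :=
  ⟨(ν : Ordinal.{u}) + n, by
    have h : ℵ₀ ≤ μ.ord.cof :=
      Ordinal.aleph0_le_cof_iff.2
        (Ordinal.one_lt_cof_iff.2 (Cardinal.isSuccLimit_ord D.aleph0_le))
    exact Ordinal.isPrincipal_add_ord h (D.E_lt ν ν.2)
      ((Ordinal.natCast_lt_omega0 n).trans_le (Cardinal.omega0_le_ord.2 h))⟩

/-- The ordinal `η_δ(i)`, as an element of `μ⁺`. -/
def etaVal (δ : D.S) (i : Set.Iio μ.ord.cof.ord) : Set.Iio (Order.succ μ).ord :=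
  ⟨D.η.ladder δ i, lt_trans (D.η.ladder δ i).2 (D.S_lt δ δ.2)⟩

/-- The ordinal `ζ_ν(n)`, as an element of `σ`. -/
def zetaVal (hσ : ℵ₀ < μ.ord.cof) (ν : D.E) (n : ℕ) : Set.Iio μ.ord.cof.ord :=
  ⟨(D.ζ hσ).ladder ν n, lt_trans ((D.ζ hσ).ladder ν n).2 (D.E_lt ν ν.2)⟩

open Classical in
/-- The element `w_{δ,ν,n} = 2 y_{δ,ν,n+1} - y_{δ,ν,n} - z_{δ,ζ_ν(n)} + x_{η_δ(ν+n)}` of `F`, where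
the `z`-term is omitted if the cofinality of `μ` is countable. -/
noncomputable def w (δ : D.S) (ν : D.E) (n : ℕ) : D.F :=
  (2 : ℤ) • FreeAbelianGroup.of (Gen.y δ ν (n + 1)) - FreeAbelianGroup.of (Gen.y δ ν n)
    - (if hσ : ℵ₀ < μ.ord.cof then FreeAbelianGroup.of (Gen.z hσ δ (D.zetaVal hσ ν n)) else 0)
    + FreeAbelianGroup.of (Gen.x (D.etaVal δ (D.shift ν n)))

/-- The subgroup `K` of `F` generated by the elements `w_{δ,ν,n}`. -/
def K : AddSubgroup D.F :=
  AddSubgroup.closure {a | ∃ δ ν n, a = D.w δ ν n}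

/-- `H` is the group built on the ladder systems `η` and `ζ`. -/
def IsBuiltOn (H : Type*) [AddCommGroup H] : Prop :=
  Nonempty (H ≃+ D.F ⧸ D.K)

end BuildingData

/-- The group `Ext(B, A) = Ext¹_ℤ(B, A)` of abelian groups. -/
abbrev ExtAb (B A : Type u) [AddCommGroup B] [AddCommGroup A] : Type u :=
  CategoryTheory.Abelian.Ext.{u} (ModuleCat.of ℤ B) (ModuleCat.of ℤ A) 1

/-- `A` is a Whitehead group: `Ext(A, ℤ) = 0`. -/
def IsWhitehead (A : Type u) [AddCommGroup A] : Prop :=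
  Subsingleton (ExtAb A (ULift.{u} ℤ))

-- Suppose `Ext(H, A) = 0`. Filter `A` by subgroups `A_γ` (`γ < λ`), each generated by fewer than
-- `λ` elements. Since `A` is Whitehead, every character `A → ℚ/ℤ` lifts to `ℚ`. If every stage `α`
-- from some point on had a later `β` with `A_β/A_α` not Whitehead, `◇_λ(Y)` would guess the partial
-- lifts of a character built to defeat each guess, and that character would have no lift
-- (`Diamond.exists_relWhitehead`). So above each `δ` there is a stage `U = A_α` with all `A_β/U`
-- Whitehead.
--
-- Such quotients do not contain a nonzero 2-divisible sequence, because `ℤ[1/2]` is not Whitehead.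
-- Hence some `b_δ` lies outside `U + 2A` (`RelWhitehead.exists_notMem_two_nsmul`), and on any `A_β`
-- containing `b_δ` there is an integral homomorphism `g` that kills `U` but not `b_δ`
-- (`RelWhitehead.exists_integral`).
--
-- Vanishing of `Ext(H, A)` gives `φ : F → A` with `φ(w_{δ,ν,n}) = ε_{ν,n} b_δ` for any zero-one
-- colouring `ε` (`BuildingData.IsBuiltOn.exists_hom`). Stationarity of `S` yields `δ` with `φ(x_β)
-- ∈ A_δ` for all `β < δ`. Applying `g` erases the `x`-terms and leaves integer solutions of
-- `2Y_{n+1} - Y_n = Z(ζ_ν(n)) + m ε_{ν,n}`, where `m = g(b_δ) ≠ 0`. The colouring is chosen to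
-- exclude this: for known `Z` each solvable `ε_ν` is determined by `m` and `Y_0`, so only countably
-- many are solvable, and `◇_σ(E)` guesses `Z` when `σ` is uncountable
-- (`BuildingData.exists_coloring`).

universe v w

/-! ### Characters into `ℚ/ℤ` -/

/-- Homomorphisms into `ℚ/ℤ` that agree on a chain of subgroups have a common extension. -/
theorem exists_character_gluing {A : Type u} [AddCommGroup A] {ι : Type v} [LinearOrder ι]
    (V : ι → AddSubgroup A) (hV : Monotone V) (χ : ι → A →+ AddCircle (1 : ℚ))
    (hχ : ∀ i j, i ≤ j → ∀ v ∈ V i, χ j v = χ i v) :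
    ∃ f : A →+ AddCircle (1 : ℚ), ∀ i, ∀ v ∈ V i, f v = χ i v := by
  rcases isEmpty_or_nonempty ι with h | h
  · exact ⟨0, fun i ↦ isEmptyElim i⟩
  have hmem : ∀ v : ↥(iSup V), ∃ i, (v : A) ∈ V i := fun v ↦
    (AddSubgroup.mem_iSup_of_directed hV.directed_le).1 v.2
  choose k hk using hmem
  have key : ∀ (v : ↥(iSup V)) i, (v : A) ∈ V i → χ (k v) v = χ i v := by
    intro v i hi
    rcases le_total i (k v) with h | h
    · exact hχ _ _ h _ hi
    · exact (hχ _ _ h _ (hk v)).symm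
  let g : ↥(iSup V) →+ AddCircle (1 : ℚ) :=
    AddMonoidHom.mk' (fun v ↦ χ (k v) v) (by
      intro a b
      have ha : (a : A) ∈ V (max (k a) (k b)) := hV (le_max_left _ _) (hk a)
      have hb : (b : A) ∈ V (max (k a) (k b)) := hV (le_max_right _ _) (hk b)
      rw [key (a + b) (max (k a) (k b)) (add_mem ha hb), key a _ ha, key b _ hb]
      simp)
  obtain ⟨f, hf⟩ := (Module.Baer.of_divisible (AddCircle (1 : ℚ))).extension_property_addMonoidHom
    (iSup V).subtype (AddSubgroup.subtype_injective _) g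
  refine ⟨f, fun i v hv ↦ ?_⟩
  have hv' : v ∈ iSup V := le_iSup V i hv
  exact (DFunLike.congr_fun hf ⟨v, hv'⟩).trans (key ⟨v, hv'⟩ i hv)

/-- An element outside a subgroup is detected by a homomorphism to `ℚ/ℤ` killing the subgroup. -/
theorem exists_character_of_notMem {A : Type u} [AddCommGroup A] (U : AddSubgroup A) {a : A}
    (ha : a ∉ U) : ∃ c : A →+ AddCircle (1 : ℚ), (∀ u ∈ U, c u = 0) ∧ c a ≠ 0 := by
  obtain ⟨c, hc⟩ := CharacterModule.exists_character_apply_ne_zero_of_ne_zero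
    (a := (QuotientAddGroup.mk' U a)) (by simpa using ha)
  refine ⟨(show A ⧸ U →+ AddCircle (1 : ℚ) from c).comp (QuotientAddGroup.mk' U), ?_, hc⟩
  intro u hu
  have : QuotientAddGroup.mk' U u = 0 := by simpa using hu
  rw [AddMonoidHom.comp_apply, this, map_zero]

/-- For subgroups `U ≤ V`, the lifting property from `ℚ/ℤ` to `ℚ` which says that `V ⧸ U` is a
Whitehead group. -/
def RelWhitehead {A : Type u} [AddCommGroup A] (U V : AddSubgroup A) : Prop :=
  ∀ f : A →+ AddCircle (1 : ℚ), (∀ u ∈ U, f u = 0) →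
    ∃ g : A →+ ℚ, (∀ u ∈ U, g u = 0) ∧ ∀ v ∈ V, ((g v : ℚ) : AddCircle (1 : ℚ)) = f v

/-! ### Integer recursions and 2-adic obstructions -/

theorem odd_multiple_of_recursion {m : ℤ} {d e : ℕ → ℤ} {k : ℕ}
    (h : ∀ n, 2 * d (n + 1) - d n = m * e n) (hk : d k = 0) (hek : Odd (e k)) (j : ℕ) :
    ∃ q, Odd q ∧ 2 ^ (j + 1) * d (k + j + 1) = m * q := by
  induction j with
  | zero => exact ⟨e k, hek, by have := h k; rw [hk] at this; simpa using this⟩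
  | succ j ih =>
    obtain ⟨q, hq, hj⟩ := ih
    refine ⟨q + 2 ^ (j + 1) * e (k + j + 1), ?_, ?_⟩
    · refine hq.add_even ?_
      rw [pow_succ, mul_assoc, mul_left_comm]
      exact even_two_mul _
    · have := h (k + j + 1)
      rw [show k + (j + 1) + 1 = k + j + 1 + 1 by ring, pow_succ, mul_add, ← hj,
        mul_left_comm m, ← this]
      ring

/-- Past the zero of `d`, the recursion makes `m` times an odd number divisible by arbitrarily high
powers of 2. -/
theorem eq_zero_of_recursion {m : ℤ} {d e : ℕ → ℤ} {k : ℕ}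
    (h : ∀ n, 2 * d (n + 1) - d n = m * e n) (hk : d k = 0) (hek : Odd (e k)) : m = 0 := by
  by_contra hm
  obtain ⟨q, hq, hj⟩ := odd_multiple_of_recursion h hk hek m.natAbs
  have h1 : (2 : ℤ) ^ (m.natAbs + 1) ∣ m := by
    refine IsCoprime.dvd_of_dvd_mul_left (y := q) (z := m) ?_
      ⟨_, (mul_comm q m).trans hj.symm⟩
    exact (Int.isCoprime_iff_gcd_eq_one.2 (by
      simpa [Int.gcd_eq_natAbs] using hq.natAbs.coprime_two_left)).pow_left
  have h2 := Nat.le_of_dvd (Int.natAbs_pos.2 hm) (Int.natAbs_dvd_natAbs.2 h1)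
  rw [Int.natAbs_pow] at h2
  have h3 : m.natAbs + 1 < 2 ^ (m.natAbs + 1) := Nat.lt_two_pow_self
  simp at h2
  omega

/-- At the first place where `ε` and `ε'` differ, the solutions still agree and the difference of
the colours is odd, which would force `m = 0`. -/
theorem recursion_coeff_unique {m : ℤ} (hm : m ≠ 0) {t Y Y' : ℕ → ℤ} {ε ε' : ℕ → Bool}
    (h : ∀ n, 2 * Y (n + 1) - Y n = t n + m * (ε n).toNat)
    (h' : ∀ n, 2 * Y' (n + 1) - Y' n = t n + m * (ε' n).toNat) (h0 : Y 0 = Y' 0) : ε = ε' := by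
  have hd : ∀ n, 2 * (Y (n + 1) - Y' (n + 1)) - (Y n - Y' n) =
      m * ((ε n).toNat - (ε' n).toNat : ℤ) := by
    intro n
    linear_combination h n - h' n
  have key : ∀ n, Y n = Y' n → ε n = ε' n := by
    intro n hn
    by_contra hne
    refine hm (eq_zero_of_recursion (d := fun n ↦ Y n - Y' n)
      (e := fun n ↦ ((ε n).toNat - (ε' n).toNat : ℤ)) (k := n) hd (by simp [hn]) ?_)
    revert hne
    cases ε n <;> cases ε' n <;> simp
  have hY : ∀ n, Y n = Y' n := by
    intro n
    induction n with
    | zero => exact h0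
    | succ n ih =>
      have := hd n
      rw [key n ih, ih] at this
      simp at this
      omega
  exact funext fun n ↦ key n (hY n)

/-- Given countably many inhomogeneous recursions, some sequence `ε` of zeros and ones makes all
of them unsolvable in the integers. -/
theorem exists_unsolvable_recursion (t : ℤ → ℕ → ℤ) :
    ∃ ε : ℕ → Bool, ∀ m : ℤ, m ≠ 0 → ∀ Y : ℕ → ℤ,
      ¬ ∀ n, 2 * Y (n + 1) - Y n = t m n + m * (ε n).toNat := by
  by_contra! hcon
  choose m hm Y hY using hcon
  have hinj : Function.Injective fun ε : ℕ → Bool ↦ (m ε, Y ε 0) := by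
    intro ε ε' h
    simp only [Prod.mk.injEq] at h
    have h1 := hY ε
    rw [h.1] at h1
    exact recursion_coeff_unique (hm ε') h1 (hY ε') h.2
  have := Cardinal.mk_le_aleph0_iff.2 hinj.countable
  simp only [mk_pi, mk_bool, prod_const, mk_nat, lift_id] at this
  exact this.not_gt (cantor ℵ₀)

/-- A homomorphism `ℚ → ℚ/ℤ` whose restriction to `ℤ[1/2]` does not lift to `ℚ`. -/
theorem exists_character_rat_not_liftable :
    ∃ κ : ℚ →+ AddCircle (1 : ℚ), ¬ ∃ r : ℚ, ∀ n : ℕ,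
      ((r / 2 ^ n : ℚ) : AddCircle (1 : ℚ)) = κ (1 / 2 ^ n) := by
  obtain ⟨ε, hε⟩ := exists_unsolvable_recursion 0
  -- Truncations of the 2-adic integer with digits `ε`. The character sends `1 / 2 ^ n` to `s n / 2
  -- ^ n`; a lift `r` would make `(r - s n) / 2 ^ n` an integer solution of the recursion with `m =
  -- -1`.
  let s : ℕ → ℤ := fun n ↦ ∑ k ∈ Finset.range n, 2 ^ k * ((ε k).toNat : ℤ)
  let V : ℕ → AddSubgroup ℚ := fun n ↦ AddSubgroup.zmultiples (1 / 2 ^ n : ℚ)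
  let χ : ℕ → ℚ →+ AddCircle (1 : ℚ) := fun n ↦
    (QuotientAddGroup.mk' (AddSubgroup.zmultiples (1 : ℚ))).comp (AddMonoidHom.mulLeft (s n : ℚ))
  have hχ : ∀ n q, χ n q = (((s n : ℚ) * q : ℚ) : AddCircle (1 : ℚ)) := fun n q ↦ rfl
  have hV : Monotone V := by
    refine monotone_nat_of_le_succ fun n ↦ ?_
    rw [AddSubgroup.zmultiples_le]
    exact AddSubgroup.mem_zmultiples_iff.2 ⟨2, by simp [pow_succ]⟩
  obtain ⟨κ, hκ⟩ := exists_character_gluing V hV χ (by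
    intro i j hij v hv
    induction j, hij using Nat.le_induction with
    | base => rfl
    | succ j hij ih =>
      rw [← ih, hχ, hχ, ← sub_eq_zero, ← AddCircle.coe_sub, AddCircle.coe_eq_zero_iff]
      obtain ⟨z, rfl⟩ := AddSubgroup.mem_zmultiples_iff.1 (hV hij hv)
      refine ⟨(ε j).toNat * z, ?_⟩
      simp only [s, Finset.sum_range_succ, zsmul_eq_mul]
      push_cast
      field_simp
      ring)
  refine ⟨κ, ?_⟩
  rintro ⟨r, hr⟩
  have h1 : ∀ n : ℕ, ∃ Y : ℤ, (Y : ℚ) = (r - s n) / 2 ^ n := by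
    intro n
    have := hr n
    rw [hκ n _ (AddSubgroup.mem_zmultiples _), hχ, ← sub_eq_zero, ← AddCircle.coe_sub,
      AddCircle.coe_eq_zero_iff] at this
    obtain ⟨Y, hY⟩ := this
    refine ⟨Y, ?_⟩
    rw [zsmul_eq_mul, mul_one] at hY
    rw [hY]
    ring
  choose Y hY using h1
  refine hε (-1) (by norm_num) Y fun n ↦ ?_
  have : (2 * (Y (n + 1) : ℚ) - Y n) = - ((ε n).toNat : ℚ) := by
    rw [hY, hY]
    simp only [s, Finset.sum_range_succ]
    push_cast
    field_simp
    ring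
  rw [Pi.zero_apply, Pi.zero_apply, zero_add, neg_one_mul]
  exact_mod_cast this

/-! ### Whitehead quotients and divisibility by 2 -/

/-- If all `V ⧸ U` for `V` generated over `U` by countably many elements are Whitehead, then a
proper subgroup `U` of `A` is not dense in the `2`-adic topology. -/
theorem RelWhitehead.exists_notMem_two_nsmul {A : Type u} [AddCommGroup A] {U : AddSubgroup A}
    (hU : U ≠ ⊤) (h : ∀ y : ℕ → A, ∃ V, RelWhitehead U V ∧ ∀ n, y n ∈ V) :
    ∃ b : A, ∀ u ∈ U, ∀ a : A, b ≠ u + 2 • a := by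
  by_contra! hcon
  obtain ⟨y₀, hy₀⟩ : ∃ y₀, y₀ ∉ U := by
    by_contra! hall
    exact hU (eq_top_iff.2 fun x _ ↦ hall x)
  choose p hp q hpq using hcon
  let y : ℕ → A := fun n ↦ q^[n] y₀
  have hy : ∀ n, y n - 2 • y (n + 1) ∈ U := by
    intro n
    have h1 : y (n + 1) = q (y n) := Function.iterate_succ_apply' q n y₀
    have h2 := hpq (y n)
    rw [h1, show y n - 2 • q (y n) = p (y n) by
      rw [sub_eq_iff_eq_add]; exact h2]
    exact hp _
  obtain ⟨V, hV, hyV⟩ := h y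
  have hpow : ∀ g : A →+ ℚ, (∀ u ∈ U, g u = 0) → ∀ n, g (y n) = g y₀ / 2 ^ n := by
    intro g hg n
    induction n with
    | zero => simp [y]
    | succ n ih =>
      have := hg _ (hy n)
      rw [map_sub, map_nsmul, ih, nsmul_eq_mul] at this
      push_cast at this
      rw [pow_succ]
      field_simp at this ⊢
      linarith
  obtain ⟨c, hcU, hc⟩ := exists_character_of_notMem U hy₀
  obtain ⟨g, hgU, hg⟩ := hV c hcU
  have hg0 : g y₀ ≠ 0 := by
    intro h0
    exact hc ((hg y₀ (hyV 0)).symm.trans (by rw [h0, AddCircle.coe_zero]))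
  -- Scaled by `(g y₀)⁻¹`, `g` maps `y n` to `1 / 2 ^ n`, so pulling `κ` back along it transfers the
  -- failure of lifting to `V`.
  obtain ⟨κ, hκ⟩ := exists_character_rat_not_liftable
  obtain ⟨g', hg'U, hg'⟩ := hV (κ.comp ((AddMonoidHom.mulLeft (g y₀)⁻¹).comp g)) (by
    intro u hu
    simp [hgU u hu])
  refine hκ ⟨g' y₀, fun n ↦ ?_⟩
  rw [← hpow g' hg'U, hg' _ (hyV n)]
  simp only [AddMonoidHom.comp_apply, AddMonoidHom.coe_mulLeft, hpow g hgU]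
  congr 1
  field_simp

/-- An element outside `U + 2A` has nonzero value under a homomorphism to `ℚ` which kills `U` and
is integral on `V`, if `V ⧸ U` is Whitehead. -/
theorem RelWhitehead.exists_integral {A : Type u} [AddCommGroup A] {U V : AddSubgroup A}
    (h : RelWhitehead U V) {b : A} (hbV : b ∈ V) (hb : ∀ u ∈ U, ∀ a : A, b ≠ u + 2 • a) :
    ∃ g : A →+ ℚ, (∀ u ∈ U, g u = 0) ∧ (∀ v ∈ V, ∃ z : ℤ, g v = z) ∧ g b ≠ 0 := by
  -- As `c` also kills `2A`, any lift of `c` takes values in `½ℤ` on `V`, and doubling it gives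
  -- integers.
  obtain ⟨c, hc, hcb⟩ := exists_character_of_notMem (a := b)
    (U ⊔ (nsmulAddMonoidHom (α := A) 2).range) (by
      intro hmem
      obtain ⟨u, hu, _, ⟨a, rfl⟩, hx⟩ := AddSubgroup.mem_sup.1 hmem
      exact hb u hu a hx.symm)
  obtain ⟨g, hgU, hg⟩ := h c fun u hu ↦ hc u (AddSubgroup.mem_sup_left hu)
  refine ⟨2 • g, fun u hu ↦ by simp [hgU u hu], fun v hv ↦ ?_, ?_⟩
  · have h1 : c (2 • v) = 0 := hc _ (AddSubgroup.mem_sup_right ⟨v, rfl⟩)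
    rw [map_nsmul, ← hg v hv, ← AddCircle.coe_nsmul, AddCircle.coe_eq_zero_iff] at h1
    obtain ⟨z, hz⟩ := h1
    exact ⟨z, by rw [AddMonoidHom.nsmul_apply, ← hz]; simp⟩
  · intro h0
    have : g b = 0 := by simpa using h0
    exact hcb ((hg b hbV).symm.trans (by rw [this, AddCircle.coe_zero]))

/-! ### Closure points in regular cardinals -/

/-- A small family in a regular cardinal is strictly bounded. -/
theorem Cardinal.IsRegular.exists_forall_lt {κ : Cardinal.{u}} (hκ : κ.IsRegular) {ι : Type v}
    (hι : Cardinal.lift.{u} #ι < Cardinal.lift.{v} κ) (g : ι → Set.Iio κ.ord) :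
    ∃ b : Set.Iio κ.ord, ∀ i, g i < b := by
  have : NoMaxOrder (Set.Iio κ.ord) := ⟨fun a ↦
    ⟨⟨_, (isSuccLimit_ord hκ.aleph0_le).succ_lt a.2⟩, Order.lt_succ a.1⟩⟩
  have hb : BddAbove (Set.range g) := by
    refine .of_not_isCofinal fun hc ↦ ?_
    have h1 := Order.cof_le hc
    rw [Ordinal.cof_Iio, ← Ordinal.lift_cof, hκ.cof_ord] at h1
    have h2 := mk_range_le_lift (f := g)
    rw [← Cardinal.lift_le.{v}] at h1
    have h3 := Cardinal.lift_lt.{max u v, u + 1}.2 hι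
    rw [lift_lift, lift_lift] at h3
    rw [lift_lift] at h1
    exact ((h1.trans h2).trans_lt h3).false
  obtain ⟨b, hb⟩ := hb
  obtain ⟨c, hc⟩ := exists_gt b
  exact ⟨c, fun i ↦ (hb ⟨i, rfl⟩).trans_lt hc⟩

theorem Cardinal.mk_Iio_lt_of_lt_ord {κ : Cardinal.{u}} (x : Set.Iio κ.ord) :
    Cardinal.lift.{u} #(Set.Iio x) < Cardinal.lift.{u + 1} κ := by
  have h : #(Set.Iio x) ≤ #(Set.Iio (x : Ordinal.{u})) :=
    mk_le_of_injective (f := fun y ↦ ⟨y.1.1, y.2⟩) fun a b h ↦ by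
      simpa [Subtype.ext_iff] using h
  rw [mk_Iio_ordinal] at h
  have h1 : Cardinal.lift.{u + 1} x.1.card < Cardinal.lift.{u + 1} κ :=
    Cardinal.lift_lt.2 (lt_ord.1 x.2)
  refine (Cardinal.lift_le.{u}.2 h).trans_lt ?_
  simpa [lift_umax] using h1

/-- A stationary subset of an uncountable regular cardinal contains a closure point of any
given function. -/
theorem StationaryIn.exists_closed {κ : Cardinal.{u}} (hκ : κ.IsRegular) (hκ' : ℵ₀ < κ)
    {S : Set Ordinal.{u}} (hS : StationaryIn κ.ord S) (f : Set.Iio κ.ord → Set.Iio κ.ord) :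
    ∃ γ : Set.Iio κ.ord, γ.1 ∈ S ∧ ∀ k < γ, f k < γ := by
  suffices h : IsClub {γ : Set.Iio κ.ord | ∀ k < γ, f k < γ} by
    obtain ⟨γ, h1, h2⟩ := hS h
    exact ⟨γ, h1, h2⟩
  refine ⟨fun d hd hne _ a ha k hk ↦ ?_, fun a ↦ ?_⟩
  · obtain ⟨x, hx, hkx⟩ := (lt_isLUB_iff ha).1 hk
    exact (hd hx k hkx).trans_le (ha.1 hx)
  · have hstep : ∀ x : Set.Iio κ.ord, ∃ b, x < b ∧ ∀ k < x, f k < b := by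
      intro x
      obtain ⟨b, hb⟩ := hκ.exists_forall_lt (mk_Iio_lt_of_lt_ord x) fun k ↦ f k
      have h2 : Cardinal.lift.{u} #Bool < Cardinal.lift.{0} κ := by
        simpa using hκ.nat_lt 2
      obtain ⟨c, hc⟩ := hκ.exists_forall_lt h2 fun i ↦ if i then b else x
      exact ⟨c, hc false, fun k hk ↦ (hb ⟨k, hk⟩).trans (hc true)⟩
    choose b hxb hb using hstep
    let s : ℕ → Set.Iio κ.ord := fun n ↦ b^[n] a
    have hs : ∀ n, s (n + 1) = b (s n) := fun n ↦ Function.iterate_succ_apply' b n a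
    -- Uncountability of `κ` bounds the sequence; its least strict upper bound is the closure point.
    have hne : {c | ∀ n, s n < c}.Nonempty := hκ.exists_forall_lt (by simpa using hκ') s
    have hmem := WellFounded.min_mem wellFounded_lt _ hne
    set γ := WellFounded.min wellFounded_lt _ hne
    refine ⟨γ, fun k hk ↦ ?_, (hmem 0).le⟩
    obtain ⟨n, hn⟩ : ∃ n, k ≤ s n := by
      by_contra! hcon
      exact WellFounded.not_lt_min wellFounded_lt (s := {c | ∀ n, s n < c}) hcon hk
    exact ((hb _ k (hn.trans_lt (hs n ▸ hxb (s n)))).trans_eq (hs (n + 1)).symm).trans (hmem _)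

/-- A diamond sequence, restated: for any function `f` there is some `γ ∈ E` closed under `f`
where a given subset is guessed. -/
theorem Diamond.exists_guess {κ : Cardinal.{u}} (hκ : κ.IsRegular) (hκ' : ℵ₀ < κ)
    {E : Set Ordinal.{u}} (hE : Diamond κ E) :
    ∃ D : Ordinal.{u} → Set Ordinal.{u}, ∀ (X : Set (Set.Iio κ.ord))
      (f : Set.Iio κ.ord → Set.Iio κ.ord), ∃ γ : Set.Iio κ.ord, γ.1 ∈ E ∧ (∀ k < γ, f k < γ) ∧
        ∀ i < γ, i ∈ X ↔ i.1 ∈ D γ := by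
  obtain ⟨D, -, hD⟩ := hE
  refine ⟨D, fun X f ↦ ?_⟩
  obtain ⟨γ, ⟨hγ, hX⟩, hf⟩ := (hD (Subtype.val '' X) (by
    rintro _ ⟨x, -, rfl⟩; exact x.2)).exists_closed hκ hκ' f
  refine ⟨γ, hγ, hf, fun i hi ↦ ?_⟩
  rw [← hX]
  constructor
  · exact fun h ↦ ⟨⟨i, h, rfl⟩, hi⟩
  · rintro ⟨⟨j, hj, hji⟩, -⟩
    rwa [← Subtype.ext hji]

/-! ### Consequences of vanishing Ext -/

/-- If `Ext(B, X) = 0`, then homomorphisms from `B` lift along surjections with kernel `X`. -/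
theorem ExtAb.exists_lift {B X I N : Type u} [AddCommGroup B] [AddCommGroup X] [AddCommGroup I]
    [AddCommGroup N] (h : Subsingleton (ExtAb B X)) (i : X →+ I) (p : I →+ N)
    (hi : Function.Injective i) (hp : Function.Surjective p) (hip : Function.Exact i p)
    (f : B →+ N) : ∃ g : B →+ I, p.comp g = f := by
  let S : CategoryTheory.ShortComplex (ModuleCat.{u} ℤ) :=
    CategoryTheory.ShortComplex.mk (ModuleCat.ofHom i.toIntLinearMap)
      (ModuleCat.ofHom p.toIntLinearMap) (by
        ext x
        exact (hip _).2 ⟨x, rfl⟩)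
  have hS : S.ShortExact := by
    have : CategoryTheory.Mono S.f := (ModuleCat.mono_iff_injective _).2 hi
    have : CategoryTheory.Epi S.g := (ModuleCat.epi_iff_surjective _).2 hp
    exact { exact := ModuleCat.shortComplex_exact S hip }
  obtain ⟨x, hx⟩ := CategoryTheory.Abelian.Ext.covariant_sequence_exact₃ (ModuleCat.of ℤ B) hS
    (CategoryTheory.Abelian.Ext.mk₀ (ModuleCat.ofHom f.toIntLinearMap : ModuleCat.of ℤ B ⟶ S.X₃))
    (zero_add 1) (h.elim _ _)
  obtain ⟨g, rfl⟩ := (CategoryTheory.Abelian.Ext.mk₀_bijective _ _).2 x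
  rw [CategoryTheory.Abelian.Ext.mk₀_comp_mk₀] at hx
  have := (CategoryTheory.Abelian.Ext.mk₀_bijective _ _).1 hx
  refine ⟨g.hom.toAddMonoidHom, ?_⟩
  ext b
  exact congrArg (fun k ↦ k.hom b) this

/-- This is lifting along `0 → ℤ → ℚ → ℚ/ℤ → 0`, with `ULift` copies to match the universe of `A`.
-/
theorem IsWhitehead.exists_lift {A : Type u} [AddCommGroup A] (hA : IsWhitehead A)
    (f : A →+ AddCircle (1 : ℚ)) :
    ∃ g : A →+ ℚ, ∀ a, ((g a : ℚ) : AddCircle (1 : ℚ)) = f a := by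
  let i : ULift.{u} ℤ →+ ULift.{u} ℚ := AddEquiv.ulift.symm.toAddMonoidHom.comp
    ((Int.castAddHom ℚ).comp AddEquiv.ulift.toAddMonoidHom)
  let p : ULift.{u} ℚ →+ ULift.{u} (AddCircle (1 : ℚ)) := AddEquiv.ulift.symm.toAddMonoidHom.comp
    ((QuotientAddGroup.mk' (AddSubgroup.zmultiples (1 : ℚ))).comp AddEquiv.ulift.toAddMonoidHom)
  suffices hex : Function.Injective i ∧ Function.Surjective p ∧ Function.Exact i p by
    obtain ⟨g, hg⟩ := ExtAb.exists_lift hA i p hex.1 hex.2.1 hex.2.2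
      (AddEquiv.ulift.symm.toAddMonoidHom.comp f)
    exact ⟨(AddEquiv.ulift (α := ℚ)).toAddMonoidHom.comp g, fun a ↦
      congrArg ULift.down (DFunLike.congr_fun hg a)⟩
  refine ⟨fun a b h ↦ ?_, ?_, ?_⟩
  · have := congrArg ULift.down h
    exact ULift.ext _ _ (Int.cast_injective (α := ℚ) this)
  · rintro ⟨x⟩
    obtain ⟨q, rfl⟩ := QuotientAddGroup.mk_surjective x
    exact ⟨⟨q⟩, rfl⟩
  · rintro ⟨q⟩
    constructor
    · intro h
      obtain ⟨n, hn⟩ := (AddCircle.coe_eq_zero_iff (1 : ℚ)).1 (congrArg ULift.down h)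
      exact ⟨⟨n⟩, ULift.ext _ _ (by rw [zsmul_eq_mul, mul_one] at hn; exact hn)⟩
    · rintro ⟨⟨n⟩, hn⟩
      rw [← hn]
      exact ULift.ext _ _ ((AddCircle.coe_eq_zero_iff (1 : ℚ)).2 ⟨n, by
        rw [zsmul_eq_mul, mul_one]; rfl⟩)

theorem IsWhitehead.relWhitehead {A : Type u} [AddCommGroup A] (hA : IsWhitehead A)
    (V : AddSubgroup A) : RelWhitehead ⊥ V := by
  intro f _
  obtain ⟨g, hg⟩ := hA.exists_lift f
  exact ⟨g, by simp, fun v _ ↦ hg v⟩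

/-- If `Ext(H, A) = 0`, then the relations defining `H` can be prescribed arbitrary values
in `A`. -/
theorem BuildingData.IsBuiltOn.exists_hom {μ : Cardinal.{u}} {D : BuildingData μ} {H A : Type u}
    [AddCommGroup H] [AddCommGroup A] (hH : D.IsBuiltOn H) (h : Subsingleton (ExtAb H A))
    (a : D.S → D.E → ℕ → A) : ∃ φ : D.F →+ A, ∀ δ ν n, φ (D.w δ ν n) = a δ ν n := by
  classical
  obtain ⟨e⟩ := hH
  -- A power of `ℚ/ℤ` into which `A` embeds; only its divisibility by 2 is used, to solve the
  -- relations there.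
  let I : Type u := (A →+ AddCircle (1 : ℚ)) → AddCircle (1 : ℚ)
  let i : A →+ I := AddMonoidHom.mk' (fun x c ↦ c x) fun x y ↦ funext fun c ↦ map_add c x y
  have hi : Function.Injective i := by
    rw [injective_iff_map_eq_zero]
    exact fun x hx ↦ CharacterModule.eq_zero_of_character_apply fun c ↦ congrFun hx c
  have hhalf : ∀ x : I, ∃ y : I, (2 : ℤ) • y = x := fun x ↦
    ⟨fun c ↦ DivisibleBy.div (x c) (2 : ℤ), funext fun c ↦
      show (2 : ℤ) • DivisibleBy.div (x c) (2 : ℤ) = x c from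
        DivisibleBy.div_cancel _ two_ne_zero⟩
  choose half hhalf using hhalf
  let Y : D.S → D.E → ℕ → I := fun δ ν n ↦
    Nat.rec 0 (fun n x ↦ half (x + i (a δ ν n))) n
  have hY : ∀ δ ν n, (2 : ℤ) • Y δ ν (n + 1) = Y δ ν n + i (a δ ν n) := fun δ ν n ↦ hhalf _
  let Ψ : D.F →+ I := FreeAbelianGroup.lift fun
    | .y δ ν n => Y δ ν n
    | .z _ _ _ => 0
    | .x _ => 0
  have hΨ : ∀ δ ν n, Ψ (D.w δ ν n) = i (a δ ν n) := by
    intro δ ν n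
    have hz : Ψ (if hσ : ℵ₀ < μ.ord.cof then
        FreeAbelianGroup.of (Gen.z hσ δ (D.zetaVal hσ ν n)) else 0) = 0 := by
      split_ifs
      · exact FreeAbelianGroup.lift_apply_of _ _
      · exact map_zero _
    unfold w
    rw [map_add, map_sub, map_sub, map_zsmul, hz]
    simp only [Ψ, FreeAbelianGroup.lift_apply_of]
    rw [hY]
    abel
  let p : I →+ I ⧸ i.range := QuotientAddGroup.mk' i.range
  have hK : ∀ x ∈ D.K, p (Ψ x) = 0 := by
    intro x hx
    refine (AddSubgroup.closure_le (K := (p.comp Ψ).ker)).2 ?_ hx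
    rintro _ ⟨δ, ν, n, rfl⟩
    exact (QuotientAddGroup.eq_zero_iff _).2 ⟨_, (hΨ δ ν n).symm⟩
  let f : H →+ I ⧸ i.range := (QuotientAddGroup.lift D.K (p.comp Ψ) hK).comp e.toAddMonoidHom
  obtain ⟨θ, hθ⟩ := ExtAb.exists_lift h i p hi (QuotientAddGroup.mk'_surjective _) (fun x ↦
    QuotientAddGroup.eq_zero_iff x) f
  let q : D.F →+ H := e.symm.toAddMonoidHom.comp (QuotientAddGroup.mk' D.K)
  -- Modulo `A`, both `Ψ` and `θ ∘ q` are the map induced on `H`. Their difference therefore lands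
  -- in `A`, and it agrees with `Ψ` on `K`, where `q` vanishes.
  have hmem : ∀ x, (Ψ - θ.comp q) x ∈ i.range := by
    intro x
    rw [← QuotientAddGroup.eq_zero_iff (N := i.range)]
    change p (Ψ x - θ (q x)) = 0
    rw [map_sub, show p (θ (q x)) = f (q x) from DFunLike.congr_fun hθ _]
    change p (Ψ x) - QuotientAddGroup.lift D.K (p.comp Ψ) hK (e (e.symm (x : D.F ⧸ D.K))) = 0
    rw [e.apply_symm_apply]
    exact sub_self _
  let φ : D.F →+ A := (AddMonoidHom.ofInjective hi).symm.toAddMonoidHom.comp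
    ((Ψ - θ.comp q).codRestrict i.range hmem)
  refine ⟨φ, fun δ ν n ↦ hi ?_⟩
  have h1 : i (φ (D.w δ ν n)) = (Ψ - θ.comp q) (D.w δ ν n) := by
    have := AddMonoidHom.apply_ofInjective_symm hi
      ((Ψ - θ.comp q).codRestrict i.range hmem (D.w δ ν n))
    exact this
  have h2 : q (D.w δ ν n) = 0 := by
    have : (QuotientAddGroup.mk' D.K) (D.w δ ν n) = 0 :=
      (QuotientAddGroup.eq_zero_iff _).2 (AddSubgroup.subset_closure ⟨δ, ν, n, rfl⟩)
    exact (congrArg e.symm this).trans (map_zero _)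
  rw [h1, AddMonoidHom.sub_apply, AddMonoidHom.comp_apply, h2, map_zero, sub_zero, hΨ]

/-! ### Guessing functions and colouring ladders -/

/-- The diamond principle predicts functions: `h γ` guesses the part of a function `g` whose graph
is coded below `γ`. -/
theorem Diamond.exists_function_guess {κ : Cardinal.{u}} (hκ : κ.IsRegular) (hκ' : ℵ₀ < κ)
    {E : Set Ordinal.{u}} (hE : Diamond κ E) {B : Type v} {C : Type w} [Nonempty C]
    {e : B × C → Set.Iio κ.ord} (he : Function.Injective e) :
    ∃ h : Set.Iio κ.ord → B → C,
      ∀ (g : B → C) (f : Set.Iio κ.ord → Set.Iio κ.ord), ∃ γ : Set.Iio κ.ord, γ.1 ∈ E ∧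
        (∀ k < γ, f k < γ) ∧ ∀ b, e (b, g b) < γ → h γ b = g b := by
  obtain ⟨D, hD⟩ := hE.exists_guess hκ hκ'
  -- The guess is read off where `D γ` codes exactly one value at `b`; elsewhere it is arbitrary.
  have hex : ∀ (γ : Set.Iio κ.ord) (b : B), ∃ c : C, ∀ c',
      e (b, c') < γ → (e (b, c')).1 ∈ D γ → (∀ c'', e (b, c'') < γ → (e (b, c'')).1 ∈ D γ →
        c'' = c') → c = c' := by
    intro γ b
    by_cases h : ∃ c', e (b, c') < γ ∧ (e (b, c')).1 ∈ D γ
    · obtain ⟨c, hc, hcD⟩ := h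
      exact ⟨c, fun c' _ _ hu ↦ hu c hc hcD⟩
    · exact ⟨Classical.arbitrary C, fun c' h1 h2 ↦ (h ⟨c', h1, h2⟩).elim⟩
  choose h hh using hex
  refine ⟨h, fun g f ↦ ?_⟩
  obtain ⟨γ, hγ, hf, hX⟩ := hD {i | ∃ b, i = e (b, g b)} f
  refine ⟨γ, hγ, hf, fun b hb ↦ hh γ b (g b) hb ((hX _ hb).1 ⟨b, rfl⟩) fun c hc hcD ↦ ?_⟩
  obtain ⟨b', hb'⟩ := (hX _ hc).2 hcD
  obtain ⟨rfl, rfl⟩ := Prod.mk.inj (he hb')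
  rfl

/-- The diamond principle gives zero-one colourings `ε` of a ladder system for which the
inhomogeneous recursions along the ladders have no simultaneous integer solutions. -/
theorem Diamond.exists_coloring {κ : Cardinal.{u}} (hκ : κ.IsRegular) (hκ' : ℵ₀ < κ)
    {E : Set Ordinal.{u}} (hE : Diamond κ E) (ζ : E → ℕ → Set.Iio κ.ord)
    (hζ : ∀ ν n, (ζ ν n : Ordinal.{u}) < ν) :
    ∃ ε : E → ℕ → Bool, ∀ m : ℤ, m ≠ 0 → ∀ Z : Set.Iio κ.ord → ℤ, ∃ ν, ∀ Y : ℕ → ℤ,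
      ¬ ∀ n, 2 * Y (n + 1) - Y n = Z (ζ ν n) + m * (ε ν n).toNat := by
  classical
  obtain ⟨e⟩ : Nonempty (Set.Iio κ.ord × ℤ ↪ Set.Iio κ.ord) := by
    rw [← Cardinal.le_def, mk_prod, mk_Iio_ordinal, card_ord]
    simp [hκ.aleph0_le]
  obtain ⟨h, hh⟩ := hE.exists_function_guess hκ hκ' e.injective
  -- At `ν` the inhomogeneous term is the guess along the ladder `ζ ν`; one `ε ν` defeats all
  -- nonzero `m` at once.
  choose ε hε using fun ν : E ↦ exists_unsolvable_recursion fun _ n ↦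
    if hν : ν.1 < κ.ord then h ⟨ν, hν⟩ (ζ ν n) else 0
  refine ⟨ε, fun m hm Z ↦ ?_⟩
  obtain ⟨γ, hγ, hf, hg⟩ := hh Z fun k ↦ e (k, Z k)
  refine ⟨⟨γ, hγ⟩, fun Y hY ↦ hε ⟨γ, hγ⟩ m hm Y fun n ↦ ?_⟩
  have hγκ : γ.1 < κ.ord := γ.2
  rw [hY n, dif_pos hγκ]
  congr 1
  exact (hg _ (hf _ (hζ ⟨γ, hγ⟩ n))).symm

/-! ### Whitehead quotients in a filtration of `A` -/

/-- Extensions of homomorphisms along a chain of subgroups can be prescribed at each step. -/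
theorem exists_character_tower {A : Type u} [AddCommGroup A] {ι : Type v} [LinearOrder ι]
    [WellFoundedLT ι] (V V' : ι → AddSubgroup A) (hV : ∀ i, V i ≤ V' i)
    (hVV : ∀ i j, i < j → V' i ≤ V j)
    (Φ : ι → (A →+ AddCircle (1 : ℚ)) → (A →+ AddCircle (1 : ℚ)))
    (hΦ : ∀ i χ, ∀ v ∈ V i, Φ i χ v = χ v) :
    ∃ ψ : A →+ AddCircle (1 : ℚ), ∀ i, ∃ χ, ∀ v ∈ V' i, ψ v = Φ i χ v := by
  classical
  have hmono : Monotone V' := by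
    intro i j hij
    rcases hij.eq_or_lt with rfl | h
    · exact le_rfl
    · exact (hVV i j h).trans (hV j)
  -- `P i` is a common extension of all earlier prescribed characters; `key` shows that one exists,
  -- so the default `0` is never taken.
  let F : ∀ i : ι, (∀ j, j < i → (A →+ AddCircle (1 : ℚ))) → (A →+ AddCircle (1 : ℚ)) :=
    fun i P ↦ if h : ∃ χ : A →+ AddCircle (1 : ℚ), ∀ j (hj : j < i), ∀ v ∈ V' j,
      χ v = Φ j (P j hj) v then h.choose else 0
  let P : ι → (A →+ AddCircle (1 : ℚ)) := (wellFounded_lt (α := ι)).fix F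
  have hP : ∀ i, P i = F i fun j _ ↦ P j := fun i ↦ WellFounded.fix_eq _ F i
  have key : ∀ i, ∀ j < i, ∀ v ∈ V' j, P i v = Φ j (P j) v := by
    intro i
    induction i using WellFoundedLT.induction with
    | _ i ih =>
      have hex : ∃ χ : A →+ AddCircle (1 : ℚ), ∀ j (_ : j < i), ∀ v ∈ V' j,
          χ v = Φ j (P j) v := by
        obtain ⟨χ, hχ⟩ := exists_character_gluing (ι := Set.Iio i) (fun j ↦ V' j)
          (fun a b hab ↦ hmono hab) (fun j ↦ Φ j (P j)) (by
            intro j k hjk v hv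
            rcases hjk.eq_or_lt with rfl | h
            · rfl
            · exact (hΦ k _ v (hVV j k h hv)).trans (ih k k.2 j h v hv))
        exact ⟨χ, fun j hj ↦ hχ ⟨j, hj⟩⟩
      intro j hj v hv
      rw [hP i]
      simp only [F]
      rw [dif_pos hex]
      exact hex.choose_spec j hj v hv
  obtain ⟨ψ, hψ⟩ := exists_character_gluing V' hmono (fun i ↦ Φ i (P i)) (by
    intro j k hjk v hv
    rcases hjk.eq_or_lt with rfl | h
    · rfl
    · exact (hΦ k _ v (hVV j k h hv)).trans (key k j h v hv))
  exact ⟨ψ, fun i ↦ ⟨P i, hψ i⟩⟩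

theorem RelWhitehead.mono_right {A : Type u} [AddCommGroup A] {U V V' : AddSubgroup A}
    (hV : V ≤ V') (h : RelWhitehead U V') : RelWhitehead U V := fun f hf ↦
  (h f hf).imp fun _ hg ↦ ⟨hg.1, fun v hv ↦ hg.2 v (hV hv)⟩

/-- If `V ⧸ ⟨s⟩` is not Whitehead, any homomorphism to `ℚ/ℤ` can be changed outside `⟨s⟩` so that
a given lift on `s` does not extend to a lift on `V`. -/
theorem exists_not_extendable_of_not_relWhitehead {A : Type u} [AddCommGroup A] {s : Set A}
    {V : AddSubgroup A} (h : ¬ RelWhitehead (AddSubgroup.closure s) V) (k : A → ℚ)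
    (χ : A →+ AddCircle (1 : ℚ)) :
    ∃ χ' : A →+ AddCircle (1 : ℚ), (∀ u ∈ AddSubgroup.closure s, χ' u = χ u) ∧
      ¬ ∃ g : A →+ ℚ, (∀ u ∈ s, g u = k u) ∧ ∀ v ∈ V, ((g v : ℚ) : AddCircle (1 : ℚ)) = χ' v := by
  by_cases hχ : ∃ g : A →+ ℚ, (∀ u ∈ s, g u = k u) ∧
      ∀ v ∈ V, ((g v : ℚ) : AddCircle (1 : ℚ)) = χ v
  · obtain ⟨g, hgU, hgV⟩ := hχ
    unfold RelWhitehead at h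
    push Not at h
    obtain ⟨θ, hθ, hθV⟩ := h
    -- Lifts of `χ` and `χ + θ` that agree on `s` would differ by a lift of `θ` killing `⟨s⟩`.
    refine ⟨χ + θ, fun u hu ↦ by simp [hθ u hu], ?_⟩
    rintro ⟨g', hgU', hgV'⟩
    have hle : AddSubgroup.closure s ≤ (g' - g).ker := (AddSubgroup.closure_le _).2 fun u hu ↦ by
      simp [AddMonoidHom.mem_ker, hgU u hu, hgU' u hu]
    obtain ⟨v, hv, hne⟩ := hθV (g' - g) hle
    refine hne ?_
    rw [AddMonoidHom.sub_apply, AddCircle.coe_sub, hgV v hv, hgV' v hv, AddMonoidHom.add_apply,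
      add_sub_cancel_left]
  · exact ⟨χ, fun _ _ ↦ rfl, hχ⟩

/-- The subgroup generated by the elements of rank below `γ`. -/
def stage {A : Type u} [AddCommGroup A] {o : Ordinal.{u}} (pos : A → Set.Iio o) (γ : Set.Iio o) :
    AddSubgroup A :=
  AddSubgroup.closure {x | pos x < γ}

theorem stage_mono {A : Type u} [AddCommGroup A] {o : Ordinal.{u}} (pos : A → Set.Iio o) :
    Monotone (stage pos) := fun _ _ h ↦
  AddSubgroup.closure_mono fun _ hx ↦ lt_of_lt_of_le hx h

theorem mem_stage {A : Type u} [AddCommGroup A] {o : Ordinal.{u}} {pos : A → Set.Iio o} {x : A}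
    {γ : Set.Iio o} (h : pos x < γ) : x ∈ stage pos γ :=
  AddSubgroup.subset_closure h

/-- Under the diamond principle for a regular cardinal `κ`, if all subgroups of `A` are Whitehead
then `A` has, beyond any given stage, stages `α` with all `A_β ⧸ A_α` Whitehead. -/
theorem Diamond.exists_relWhitehead {κ : Cardinal.{u}} (hκ : κ.IsRegular) (hκ' : ℵ₀ < κ)
    {Y : Set Ordinal.{u}} (hY : Diamond κ Y) (hY0 : ∀ γ ∈ Y, 0 < γ) {A : Type u} [AddCommGroup A]
    {e : A × ℚ → Set.Iio κ.ord} (he : Function.Injective e) {pos : A → Set.Iio κ.ord}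
    (hpos : Function.Injective pos) (hA : ∀ V : AddSubgroup A, RelWhitehead ⊥ V)
    (δ : Set.Iio κ.ord) :
    ∃ α, δ ≤ α ∧ ∀ β, RelWhitehead (stage pos α) (stage pos β) := by
  by_contra! hcon
  have hex : ∀ α, ∃ β, α < β ∧ (δ ≤ α → ¬ RelWhitehead (stage pos α) (stage pos β)) := by
    intro α
    obtain ⟨c, hc⟩ := hκ.exists_forall_lt (ι := ℕ) (by simpa using hκ') fun _ ↦ α
    by_cases h : δ ≤ α
    · obtain ⟨β, hβ⟩ := hcon α h
      exact ⟨max β c, (hc 0).trans_le (le_max_right _ _), fun _ hW ↦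
        hβ (hW.mono_right (stage_mono pos (le_max_left _ _)))⟩
    · exact ⟨c, hc 0, fun h' ↦ (h h').elim⟩
  choose f hf hfW using hex
  obtain ⟨h, hh⟩ := hY.exists_function_guess hκ hκ' he
  -- Only closure points of `f` are used, so that `stage pos (f i)` lies in every later stage. The
  -- guess `h i.1` need not be additive, since it is compared with a lift on generators only.
  choose Φ hΦ hΦ' using fun (i : {γ : Set.Iio κ.ord // δ ≤ γ ∧ ∀ k < γ, f k < γ}) ↦
    exists_not_extendable_of_not_relWhitehead (hfW i.1 i.2.1) (h i.1)
  obtain ⟨ψ, hψ⟩ := exists_character_tower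
    (fun i : {γ : Set.Iio κ.ord // δ ≤ γ ∧ ∀ k < γ, f k < γ} ↦ stage pos i.1)
    (fun i ↦ stage pos (f i.1)) (fun i ↦ stage_mono pos (hf i.1).le)
    (fun i j hij ↦ stage_mono pos (j.2.2 i.1 hij).le) Φ hΦ
  obtain ⟨g, -, hg⟩ := hA ⊤ ψ (by simp)
  -- Closure under this function makes `γ` an index of the tower, puts it above `δ` (evaluate at `0
  -- < γ`), and places the codes of `g` on the generators of `stage pos γ` below `γ`, where they are
  -- guessed.
  obtain ⟨γ, hγ, hclosed, hguess⟩ := hh g fun k ↦ max (max (f k) δ)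
    (e (Function.invFun pos k, g (Function.invFun pos k)))
  simp only [max_lt_iff] at hclosed
  have hδ : δ ≤ γ := (hclosed ⟨0, (hY0 γ hγ).trans γ.2⟩ (hY0 γ hγ)).1.2.le
  obtain ⟨χ, hχ⟩ := hψ ⟨γ, hδ, fun k hk ↦ (hclosed k hk).1.1⟩
  refine hΦ' ⟨γ, hδ, fun k hk ↦ (hclosed k hk).1.1⟩ χ ⟨g, fun x hx ↦ ?_, fun v hv ↦ ?_⟩
  · have h1 := (hclosed (pos x) hx).2
    rw [Function.leftInverse_invFun hpos] at h1
    exact (hguess x h1).symm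
  · rw [hg v trivial, hχ v hv]

/-- A group generated by fewer than `κ` elements has cardinality below `κ`, as `κ` is uncountable.
-/
theorem stage_ne_top {A : Type u} [AddCommGroup A] {κ : Cardinal.{u}} (hκ : ℵ₀ < κ)
    (hA : κ ≤ #A) {pos : A → Set.Iio κ.ord} (hpos : Function.Injective pos) (γ : Set.Iio κ.ord) :
    stage pos γ ≠ ⊤ := by
  intro h
  have hs : #{x | pos x < γ} < κ := by
    have h1 := lift_mk_le_lift_mk_of_injective (f := fun x : {x | pos x < γ} ↦ (⟨pos x, x.2⟩ : Set.Iio γ))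
      fun x y hxy ↦ Subtype.ext (hpos (congrArg Subtype.val hxy))
    have h2 := Cardinal.mk_Iio_lt_of_lt_ord γ
    rw [Cardinal.lift_id'.{u, u + 1}] at h2
    exact Cardinal.lift_lt.1 ((h1.trans_eq (Cardinal.lift_id'.{u, u + 1} _)).trans_lt h2)
  have hsurj : Function.Surjective
      (FreeAbelianGroup.lift (Subtype.val : {x | pos x < γ} → A)) := by
    rw [← AddMonoidHom.range_eq_top, eq_top_iff, ← h, stage, AddSubgroup.closure_le]
    exact fun x hx ↦ ⟨FreeAbelianGroup.of ⟨x, hx⟩, FreeAbelianGroup.lift_apply_of _ _⟩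
  have h1 := mk_le_of_surjective hsurj
  rw [mk_congr (FreeAbelianGroup.equivFinsupp {x | pos x < γ}).toEquiv] at h1
  have h2 : #({x | pos x < γ} →₀ ℤ) ≤ max #{x | pos x < γ} ℵ₀ := by
    rcases isEmpty_or_nonempty {x | pos x < γ} with he | he
    · exact (mk_le_aleph0_iff.2 inferInstance).trans (le_max_right _ _)
    · rw [mk_finsupp_lift_of_infinite']
      simp
  exact ((hA.trans h1).trans h2).not_gt (max_lt hs hκ)

/-! ### Colouring the relations and the final contradiction -/

namespace BuildingData

variable {μ : Cardinal.{u}} (D : BuildingData μ)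

/-- There are zero-one colourings of the relations for which the induced recursions have no
simultaneous integer solution. -/
theorem exists_coloring (hE : ℵ₀ < μ.ord.cof → Diamond μ.ord.cof D.E) :
    ∃ ε : D.E → ℕ → Bool, ∀ m : ℤ, m ≠ 0 →
      ∀ Z : (hσ : ℵ₀ < μ.ord.cof) → Set.Iio μ.ord.cof.ord → ℤ, ∃ ν, ∀ Y : ℕ → ℤ,
        ¬ ∀ n, 2 * Y (n + 1) - Y n =
          (if hσ : ℵ₀ < μ.ord.cof then Z hσ (D.zetaVal hσ ν n) else 0) +
            m * (ε ν n).toNat := by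
  have hlim : Order.IsSuccLimit μ.ord := isSuccLimit_ord D.aleph0_le
  have hreg := isRegular_cof hlim
  by_cases hσ : ℵ₀ < μ.ord.cof
  · obtain ⟨ε, hε⟩ := (hE hσ).exists_coloring hreg hσ (D.zetaVal hσ) fun ν n ↦
      ((D.ζ hσ).ladder ν n).2
    refine ⟨ε, fun m hm Z ↦ ?_⟩
    obtain ⟨ν, hν⟩ := hε m hm (Z hσ)
    exact ⟨ν, fun Y hY ↦ hν Y fun n ↦ by rw [hY n, dif_pos hσ]⟩
  · obtain ⟨ε, hε⟩ := exists_unsolvable_recursion 0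
    have h0 : (0 : Ordinal.{u}) ∈ D.E := by
      rw [D.E_eq (le_antisymm (not_lt.1 hσ) hreg.aleph0_le)]
      rfl
    exact ⟨fun _ ↦ ε, fun m hm Z ↦ ⟨⟨0, h0⟩, fun Y hY ↦ hε m hm Y fun n ↦ by
      rw [hY n, dif_neg hσ]; rfl⟩⟩

end BuildingData

theorem mainTheorem8
    (gch : GCH.{u})
    (μ : Cardinal.{u}) (hμ : μ.IsSingular)
    (D : BuildingData μ)
    (hS : StationaryIn (Order.succ μ).ord D.S)
    (Y : Set Ordinal.{u})
    (hY_lt : ∀ α ∈ Y, α < (Order.succ μ).ord)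
    (hY_cof : ∀ α ∈ Y, α.cof = μ.ord.cof)
    (hY : Diamond (Order.succ μ) Y)
    (hE : ℵ₀ < μ.ord.cof → Diamond μ.ord.cof D.E)
    (H : Type u) [AddCommGroup H] (hH : D.IsBuiltOn H)
    (A : Type u) [AddCommGroup A] (hA : IsWhitehead A) (hA_card : #A = Order.succ μ) :
    Nontrivial (ExtAb H A) := by
  by_contra hnt
  rw [not_nontrivial_iff_subsingleton] at hnt
  have hκ : (Order.succ μ).IsRegular := isRegular_succ D.aleph0_le
  have hκ' : ℵ₀ < Order.succ μ := Order.lt_succ_of_le D.aleph0_le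
  have hcof : ℵ₀ ≤ μ.ord.cof := (isRegular_cof (isSuccLimit_ord D.aleph0_le)).aleph0_le
  have hY0 : ∀ γ ∈ Y, 0 < γ := by
    intro γ hγ
    rw [pos_iff_ne_zero]
    rintro rfl
    have := hY_cof _ hγ
    rw [Ordinal.cof_zero] at this
    exact (aleph0_pos.trans_le hcof).ne this
  obtain ⟨e⟩ : Nonempty (A × ℚ ↪ Set.Iio (Order.succ μ).ord) := by
    rw [← Cardinal.lift_mk_le', mk_prod, mk_Iio_ordinal, card_ord, hA_card]
    simp [hκ.aleph0_le]
  let pos : A → Set.Iio (Order.succ μ).ord := fun a ↦ e (a, 0)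
  have hpos : Function.Injective pos := fun a b h ↦ (Prod.mk.inj (e.injective h)).1
  have hgood := hY.exists_relWhitehead hκ hκ' hY0 e.injective hpos hA.relWhitehead
  choose α hδα hα using fun δ : D.S ↦ hgood ⟨δ, D.S_lt δ δ.2⟩
  choose b hb using fun δ : D.S ↦ RelWhitehead.exists_notMem_two_nsmul
    (stage_ne_top hκ' hA_card.ge hpos (α δ)) fun y ↦ by
      obtain ⟨β, hβ⟩ := hκ.exists_forall_lt (by simpa using hκ') fun n ↦ pos (y n)
      exact ⟨_, hα δ β, fun n ↦ mem_stage (hβ n)⟩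
  obtain ⟨ε, hε⟩ := D.exists_coloring hE
  obtain ⟨φ, hφ⟩ := hH.exists_hom hnt fun δ ν n ↦ (ε ν n).toNat • b δ
  -- The ladder at `δ` has values below `δ`, so all `x`-terms in its relations are mapped by `φ`
  -- into the stage of `δ`, hence into that of `α δ`.
  obtain ⟨δ', hδ, hclosed⟩ := hS.exists_closed hκ hκ' fun k ↦
    pos (φ (FreeAbelianGroup.of (.x k)))
  obtain ⟨δ, rfl⟩ : ∃ δ : D.S, δ' = ⟨δ, D.S_lt δ δ.2⟩ := ⟨⟨δ', hδ⟩, rfl⟩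
  let y : D.E → ℕ → A := fun ν n ↦ φ (FreeAbelianGroup.of (.y δ ν n))
  let z : ∀ _ : ℵ₀ < μ.ord.cof, Set.Iio μ.ord.cof.ord → A := fun hσ j ↦
    φ (FreeAbelianGroup.of (.z hσ δ j))
  -- For fixed `δ` there are at most `σ < λ` generators `y` and `z`, so their images and `b δ` lie
  -- in one stage.
  have hσμ : Cardinal.lift.{u + 1} μ.ord.cof < Cardinal.lift.{u + 1} (Order.succ μ) :=
    Cardinal.lift_lt.2 (hμ.cof_ord_lt.trans (Order.lt_succ μ))
  have hcardσ : #(Set.Iio μ.ord.cof.ord) = Cardinal.lift.{u + 1} μ.ord.cof := by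
    rw [mk_Iio_ordinal, card_ord]
  obtain ⟨β₁, hβ₁⟩ := hκ.exists_forall_lt (ι := D.E × ℕ) (by
    have h1 : #D.E ≤ #(Set.Iio μ.ord.cof.ord) := mk_le_mk_of_subset D.E_lt
    rw [hcardσ] at h1
    have h2 : #(D.E × ℕ) ≤ Cardinal.lift.{u + 1} μ.ord.cof := by
      rw [mk_prod, mk_nat, lift_aleph0, lift_uzero]
      exact (mul_le_mul' h1 le_rfl).trans (mul_le_of_le (aleph0_le_lift.2 hcof) le_rfl
        (aleph0_le_lift.2 hcof))
    exact (Cardinal.lift_id'.{u, u + 1} _).trans_lt (h2.trans_lt hσμ)) fun p ↦ pos (y p.1 p.2)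
  obtain ⟨β₂, hβ₂⟩ := hκ.exists_forall_lt (ι := {_j : Set.Iio μ.ord.cof.ord // ℵ₀ < μ.ord.cof}) (by
    have h1 : #{_j : Set.Iio μ.ord.cof.ord // ℵ₀ < μ.ord.cof} ≤ #(Set.Iio μ.ord.cof.ord) :=
      mk_subtype_le _
    rw [hcardσ] at h1
    exact (Cardinal.lift_id'.{u, u + 1} _).trans_lt (h1.trans_lt hσμ)) fun j ↦ pos (z j.2 j.1)
  obtain ⟨β₃, hβ₃⟩ := hκ.exists_forall_lt (ι := ℕ) (by simpa using hκ') fun _ ↦ pos (b δ)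
  obtain ⟨g, hgU, hgV, hgb⟩ := (hα δ (max β₁ (max β₂ β₃))).exists_integral
    (mem_stage ((hβ₃ 0).trans_le (by simp))) (hb δ)
  obtain ⟨m, hm⟩ := hgV _ (mem_stage ((hβ₃ 0).trans_le (by simp)))
  have hm0 : m ≠ 0 := by
    rintro rfl
    exact hgb (by simpa using hm)
  choose Yv hYv using fun ν n ↦ hgV (y ν n) (mem_stage ((hβ₁ (ν, n)).trans_le (by simp)))
  choose Zv hZv using fun hσ j ↦ hgV (z hσ j) (mem_stage ((hβ₂ ⟨j, hσ⟩).trans_le (by simp)))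
  obtain ⟨ν, hν⟩ := hε m hm0 Zv
  refine hν (Yv ν) fun n ↦ ?_
  have hw := congrArg g (hφ δ ν n)
  have hx : g (φ (FreeAbelianGroup.of (.x (D.etaVal δ (D.shift ν n))))) = 0 :=
    hgU _ (stage_mono pos (hδα δ) (mem_stage (hclosed _ (D.η.ladder δ (D.shift ν n)).2)))
  have hz : g (φ (if hσ : ℵ₀ < μ.ord.cof then
      FreeAbelianGroup.of (.z hσ δ (D.zetaVal hσ ν n)) else 0)) =
      ((if hσ : ℵ₀ < μ.ord.cof then Zv hσ (D.zetaVal hσ ν n) else 0 : ℤ) : ℚ) := by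
    split_ifs with hσ
    · exact hZv hσ _
    · simp
  have hy : ∀ n, g (φ (FreeAbelianGroup.of (.y δ ν n))) = Yv ν n := hYv ν
  unfold BuildingData.w at hw
  simp only [map_add, map_sub, map_zsmul, map_nsmul, hx, hz, hy, hm, zsmul_eq_mul,
    nsmul_eq_mul] at hw
  have : (2 * (Yv ν (n + 1) : ℚ) - Yv ν n) =
      ((if hσ : ℵ₀ < μ.ord.cof then Zv hσ (D.zetaVal hσ ν n) else 0 : ℤ) : ℚ) +
        m * ((ε ν n).toNat : ℚ) := by
    push_cast at hw ⊢
    linear_combination hw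
  exact_mod_cast this
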